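/- Let $E$ be an abstract error group, i.e. a finite group with a faithful irreducible unitary representation $\rho$ of degree $|E:Z(E)|^{1/2}$ on a finite-dimensional complex Hilbert space $H$, and suppose that $E'\subseteq Z(E)$. Let $C$ be a Clifford code with data $(E,\rho,N,\chi)$: $N$ is a normal subgroup of $E$, $\chi$ is an irreducible complex character of $N$ with $\frac1{|N|}\sum_{n\in N}\chi(n)\,\mathrm{Tr}\,\rho(n^{-1})>0$, and $C$ is the image of $\frac{\chi(1)}{|N|}\sum_{n\in N}\chi(n^{-1})\rho(n)$. Then the inertia group $I_E(\chi)=\{g\in E : \chi(gxg^{-1})=\chi(x)\text{ for all }x\in N\}$ equals the centralizer $C_E(Z(N))$. If moreover $C_E(Z(N))=LN$ for some subgroup $L$ of $E$ with $[L,N]=1$, then $C$ is an operator quantum error-correcting code $C=A\otimes B$ (a tensor product of Hilbert spaces, so that $H=(A\otimes B)\oplus C^\perp$), where $A$ is an irreducible $\mathbf{C}L$-module, $B$ is an irreducible $\mathbf{C}N$-module with character $\chi$, and $\rho(\ell n)$ acts on $C$ as $\ell\otimes n$ for $\ell\in L$, $n\in N$, such that (i) $\dim A=|Z(E)\cap N|\,|E:Z(E)|^{1/2}\,|N:Z(N)|^{1/2}/|N|$,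 (ii) $\dim B=|N:Z(N)|^{1/2}$. An error $e\in E$ is detectable by the subsystem $A$ if and only if $e$ lies in $E-(C_E(Z(N))-Z(L)N)$. Here $e$ is detectable by $A$ if, with $P$ the orthogonal projector onto $C$, the operator $P\rho(e)P$ acts on $C=A\otimes B$ as $1_A\otimes M$ for some linear operator $M$ on $B$. -/

import Mathlib

open scoped TensorProduct ComplexOrder Pointwise

noncomputable section

namespace CliffordCode

section Representations

variable {E H : Type*} [Group E] [NormedAddCommGroup H] [InnerProductSpace ℂ H]

/-- `ρ` turns the finite group `E` into an abstract error group: it is a faithful irreducible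
unitary representation of degree `|E : Z(E)|^{1/2}`. -/
structure IsErrorRepresentation (ρ : Representation ℂ E H) : Prop where
  faithful : Function.Injective ρ
  irreducible : ρ.IsIrreducible
  unitary : ∀ (g : E) (x y : H), inner ℂ (ρ g x) (ρ g y) = inner ℂ x y
  degree : (Module.finrank ℂ H : ℝ) = Real.sqrt ((Subgroup.center E).index : ℝ)

/-- `χ` is an irreducible complex character of the group `E` (an element of `Irr(E)`). -/
def IsIrreducibleCharacter (χ : E → ℂ) : Prop :=
  ∃ (n : ℕ) (σ : Representation ℂ E (Fin n → ℂ)), σ.IsIrreducible ∧ χ = σ.character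

/-- The scalar product `(χ, ψ) = |E|⁻¹ ∑ χ(n) ψ(n⁻¹)` of functions on a finite group. -/
def charInner [Fintype E] (χ ψ : E → ℂ) : ℂ :=
  (Fintype.card E : ℂ)⁻¹ * ∑ n : E, χ n * ψ n⁻¹

/-- `(E, ρ, N, χ)` is the data of a Clifford code: `ρ` is the representation of the abstract error
group `E`, `χ` is an irreducible character of the normal subgroup `N`, and `χ` occurs in the
restriction to `N` of the character `φ` of `ρ`, that is, `(χ, φ_N)_N > 0`. -/
structure IsCliffordData (ρ : Representation ℂ E H) (N : Subgroup E) [N.Normal] [Fintype N]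
    (χ : N → ℂ) : Prop where
  errorRep : IsErrorRepresentation ρ
  irreducible : IsIrreducibleCharacter χ
  pos : 0 < charInner χ (fun n : N => ρ.character (n : E))

/-- The operator `P = χ(1) / |N| ∑ χ(n⁻¹) ρ(n)`. -/
def projector (ρ : Representation ℂ E H) (N : Subgroup E) [Fintype N] (χ : N → ℂ) :
    H →ₗ[ℂ] H :=
  (χ 1 / (Fintype.card N : ℂ)) • ∑ n : N, χ n⁻¹ • ρ (n : E)

/-- The Clifford code with data `(E, ρ, N, χ)`: the image of `P`. -/
def code (ρ : Representation ℂ E H) (N : Subgroup E) [Fintype N] (χ : N → ℂ) :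
    Submodule ℂ H :=
  LinearMap.range (projector ρ N χ)

end Representations

section Groups

variable {E : Type*} [Group E]

/-- The inertia group `I_E(χ) = {g ∈ E | χ(g x g⁻¹) = χ(x) for all x ∈ N}`. -/
def inertiaGroup (N : Subgroup E) [N.Normal] (χ : N → ℂ) : Subgroup E where
  carrier := {g | ∀ x : N, χ (MulAut.conjNormal g x) = χ x}
  mul_mem' := by
    intro a b ha hb x
    rw [map_mul, MulAut.mul_apply, ha, hb]
  one_mem' := by
    intro x
    rw [map_one, MulAut.one_apply]
  inv_mem' := by
    intro a ha x
    have h := ha (MulAut.conjNormal a⁻¹ x)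
    rw [← MulAut.mul_apply, ← map_mul, mul_inv_cancel, map_one, MulAut.one_apply] at h
    exact h.symm

/-- The center `Z(S)` of a subgroup `S` of `E`, as a subgroup of `E`. -/
def centerOf (S : Subgroup E) : Subgroup E :=
  (Subgroup.center S).map S.subtype

/-- The centralizer `C_E(Z(S))` in `E` of the center of a subgroup `S`. -/
def centralizerOfCenter (S : Subgroup E) : Subgroup E :=
  Subgroup.centralizer (centerOf S : Set E)

end Groups

section OperatorCodes

variable {H : Type*} [NormedAddCommGroup H] [InnerProductSpace ℂ H]

/-- A subspace `C` of `H` as an operator quantum error-correcting code: a decomposition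
`C = A ⊗ B` as a tensor product of finite-dimensional Hilbert spaces (so that
`H = (A ⊗ B) ⊕ Cᗮ`). -/
structure OperatorCode (C : Submodule ℂ H) where
  /-- the subsystem -/
  A : Type
  /-- the co-subsystem -/
  B : Type
  [normedA : NormedAddCommGroup A]
  [innerA : InnerProductSpace ℂ A]
  [finiteA : FiniteDimensional ℂ A]
  [normedB : NormedAddCommGroup B]
  [innerB : InnerProductSpace ℂ B]
  [finiteB : FiniteDimensional ℂ B]
  /-- the identification of `A ⊗ B` with `C` -/
  iso : (A ⊗[ℂ] B) ≃ₗᵢ[ℂ] C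

attribute [instance] OperatorCode.normedA OperatorCode.innerA OperatorCode.finiteA
  OperatorCode.normedB OperatorCode.innerB OperatorCode.finiteB

/-- An error operator `T` on `H` is detectable by the subsystem `A` of `C = A ⊗ B` if its
compression `P T P` to `C`, with `P` the orthogonal projector onto `C`, acts on `C = A ⊗ B` by
scalar multiplication on `A` and arbitrarily on `B`, that is, as `1_A ⊗ M` for some linear
operator `M` on `B` (the scalar is absorbed in `M`). -/
def OperatorCode.Detects [FiniteDimensional ℂ H] {C : Submodule ℂ H} (D : OperatorCode C)
    (T : H →ₗ[ℂ] H) : Prop :=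
  ∃ M : D.B →ₗ[ℂ] D.B, ∀ (a : D.A) (b : D.B),
    C.starProjection (T (D.iso (a ⊗ₜ[ℂ] b) : H)) = (D.iso (a ⊗ₜ[ℂ] M b) : H)

/-- For commuting subgroups `L`, `N` of `E` and a code `C = A ⊗ B` in the space of the
representation `ρ` of `E`: `A` is an irreducible `ℂL`-module, `B` is an irreducible `ℂN`-module
with character `χ`, and `ρ(ℓ n)` acts on `C = A ⊗ B` as the action of `ℓ` on `A` tensored with
the action of `n` on `B`. -/
def OperatorCode.IsCompatible {E : Type*} [Group E] (ρ : Representation ℂ E H) (L N : Subgroup E)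
    (χ : N → ℂ) {C : Submodule ℂ H} (D : OperatorCode C) : Prop :=
  ∃ (α : Representation ℂ L D.A) (β : Representation ℂ N D.B),
    α.IsIrreducible ∧ β.IsIrreducible ∧ β.character = χ ∧
    ∀ (l : L) (n : N) (a : D.A) (b : D.B),
      ρ ((l : E) * (n : E)) (D.iso (a ⊗ₜ[ℂ] b) : H) = (D.iso (α l a ⊗ₜ[ℂ] β n b) : H)

end OperatorCodes

end CliffordCode

end

/-! Commutators in `E` are central, so by Schur each acts in `ρ` as a scalar, and by faithfulness
that scalar is 1 only if the commutator is trivial. Everything rests on this. Since `χ` occurs in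
`ρ`, comparing its values at `n` and at the conjugate `m n m⁻¹ = ⁅m, n⁆ n` shows that it vanishes
off `Z(N)`. On `Z(N)` it has no zeros, which yields both the inertia group and `χ(1)² = |N : Z(N)|`.

For the tensor structure, `B` is a unitary model of `χ` inside `H` and `A = Hom_N(B, H)`. By Schur
`⟨Sx, Ty⟩` is a multiple of `⟨x, y⟩`, and this multiple is the inner product of `A`, so evaluation
`A ⊗ B → H` is an isometry. `L` acts on `A` by postcomposition. The key is `code_le_of_invariant`:
errors outside the inertia group `LN` send the code into `ker P`, so irreducibility of `ρ` forces
any nonzero `LN`-invariant subspace fixed pointwise by `P` to contain the code. This gives at once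
`A ⊗ B = C` and the irreducibility of `A`. The dimension of `A` then comes from the trace of `P`.

For detection, an error outside `LN` maps `C` into its orthogonal complement. Inside, `ℓ n` acts as
`α ℓ ⊗ β n`, which has the form `1 ⊗ M` exactly when `α ℓ` is a scalar, that is, when `ℓ ∈ Z(L)`. -/

noncomputable section

namespace CliffordCode

/-! ### Irreducibility by invariant subspaces, and Schur's lemma. -/

section Schur

variable {k G V W : Type*} [Field k] [Group G] [AddCommGroup V] [Module k V] [AddCommGroup W]
  [Module k W]

theorem eq_bot_or_eq_top_of_invariant {σ : Representation k G V} (hσ : σ.IsIrreducible)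
    (U : Submodule k V) (hU : ∀ g, ∀ v ∈ U, σ g v ∈ U) : U = ⊥ ∨ U = ⊤ := by
  rcases hσ.eq_bot_or_eq_top (⟨U, fun g v hv => hU g v hv⟩ : Subrepresentation σ) with h | h
  · exact Or.inl (congrArg Subrepresentation.toSubmodule h)
  · exact Or.inr (congrArg Subrepresentation.toSubmodule h)

theorem isIrreducible_of_invariant [Nontrivial V] {σ : Representation k G V}
    (h : ∀ U : Submodule k V, (∀ g, ∀ v ∈ U, σ g v ∈ U) → U = ⊥ ∨ U = ⊤) : σ.IsIrreducible where
  exists_pair_ne := ⟨⊥, ⊤, fun hbt =>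
    bot_ne_top (α := Submodule k V) (congrArg Subrepresentation.toSubmodule hbt)⟩
  eq_bot_or_eq_top U := by
    rcases h U.toSubmodule (fun g v hv => U.apply_mem_toSubmodule g hv) with h | h
    · exact Or.inl (Subrepresentation.toSubmodule_injective h)
    · exact Or.inr (Subrepresentation.toSubmodule_injective h)

theorem nontrivial_of_isIrreducible {σ : Representation k G V} (hσ : σ.IsIrreducible) :
    Nontrivial V := by
  by_contra hV
  rw [not_nontrivial_iff_subsingleton] at hV
  obtain ⟨U, U', h⟩ := hσ.exists_pair_ne
  exact h (Subrepresentation.toSubmodule_injective (Subsingleton.elim _ _))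

theorem isIrreducible_of_linearEquiv {σ : Representation k G V} {τ : Representation k G W}
    (hσ : σ.IsIrreducible) (u : V ≃ₗ[k] W) (hu : ∀ g v, u (σ g v) = τ g (u v)) :
    τ.IsIrreducible := by
  have := nontrivial_of_isIrreducible hσ
  have : Nontrivial W := u.injective.nontrivial
  refine isIrreducible_of_invariant fun U hU => ?_
  have := eq_bot_or_eq_top_of_invariant hσ (U.comap u.toLinearMap) fun g v hv => by
    simp only [Submodule.mem_comap, LinearEquiv.coe_coe] at hv ⊢
    rw [hu]
    exact hU g _ hv
  refine this.imp (fun h => ?_) (fun h => ?_)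
  · rw [eq_bot_iff]
    intro w hw
    have : u.symm w ∈ U.comap u.toLinearMap := by simpa using hw
    rw [h] at this
    simpa using this
  · rw [eq_top_iff]
    intro w _
    have : u.symm w ∈ U.comap u.toLinearMap := by simp [h]
    simpa using this

theorem exists_eq_smul_of_commute [IsAlgClosed k] [FiniteDimensional k V]
    {σ : Representation k G V} (hσ : σ.IsIrreducible) (f : V →ₗ[k] V)
    (hf : ∀ g v, f (σ g v) = σ g (f v)) : ∃ c : k, ∀ v, f v = c • v := by
  let F : σ.IntertwiningMap σ := ⟨f, fun g => LinearMap.ext fun v => hf g v⟩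
  obtain ⟨c, hc⟩ :=
    (Representation.IsIrreducible.algebraMap_intertwiningMap_bijective_of_isAlgClosed
      (ρ := σ)).2 F
  refine ⟨c, fun v => ?_⟩
  exact (congrArg (fun T : σ.IntertwiningMap σ => T v) hc).symm

theorem exists_eq_smul_of_mem_center [IsAlgClosed k] [FiniteDimensional k V]
    {σ : Representation k G V} (hσ : σ.IsIrreducible) {z : G} (hz : z ∈ Subgroup.center G) :
    ∃ c : k, ∀ v, σ z v = c • v :=
  exists_eq_smul_of_commute hσ (σ z) fun g v => by
    rw [← Module.End.mul_apply, ← Module.End.mul_apply, ← map_mul, ← map_mul,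
      Subgroup.mem_center_iff.1 hz g]

theorem apply_ne_zero {σ : Representation k G V} (g : G) {v : V} (hv : v ≠ 0) : σ g v ≠ 0 :=
  fun h => hv (by rw [← σ.inv_self_apply g v, h, map_zero])

end Schur

section Conjugate

variable {k G V W : Type*} [Field k] [Group G] [AddCommGroup V] [Module k V] [AddCommGroup W]
  [Module k W]

/-- Transport of a representation along a linear equivalence. -/
def conjRepresentation (σ : Representation k G V) (u : V ≃ₗ[k] W) : Representation k G W where
  toFun g := u.conj (σ g)
  map_one' := by rw [map_one]; exact u.conj_id
  map_mul' g h := by rw [map_mul]; exact u.conj_comp _ _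

theorem conjRepresentation_apply (σ : Representation k G V) (u : V ≃ₗ[k] W) (g : G) (w : W) :
    conjRepresentation σ u g w = u (σ g (u.symm w)) :=
  rfl

end Conjugate

/-! ### Unitary models and multiplicity spaces with their inner products. -/

section Unitary

variable {G H B : Type*} [Group G] [NormedAddCommGroup H] [InnerProductSpace ℂ H]
  [NormedAddCommGroup B] [InnerProductSpace ℂ B] [FiniteDimensional ℂ H] [FiniteDimensional ℂ B]

omit [FiniteDimensional ℂ H] in
theorem inner_apply_left {τ : Representation ℂ G H}
    (hτ : ∀ g x y, inner ℂ (τ g x) (τ g y) = inner ℂ x y) (g : G) (x y : H) :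
    inner ℂ (τ g x) y = inner ℂ x (τ g⁻¹ y) := by
  conv_lhs => rw [← τ.self_inv_apply g y]
  rw [hτ]

/-- Unitarity of both representations makes `S† T` commute with `β`, so Schur's lemma applies to it.
-/
theorem exists_inner_eq_mul_inner {τ : Representation ℂ G H} {β : Representation ℂ G B}
    (hτ : ∀ g x y, inner ℂ (τ g x) (τ g y) = inner ℂ x y)
    (hβ : ∀ g x y, inner ℂ (β g x) (β g y) = inner ℂ x y) (hirr : β.IsIrreducible)
    (S T : β.IntertwiningMap τ) :
    ∃ c : ℂ, ∀ x y, inner ℂ (S x) (T y) = c * inner ℂ x y := by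
  have key : ∀ x y, inner ℂ (S x) (T y) =
      inner ℂ x ((LinearMap.adjoint S.toLinearMap ∘ₗ T.toLinearMap) y) := fun x y => by
    rw [LinearMap.comp_apply, LinearMap.adjoint_inner_right]
    rfl
  obtain ⟨c, hc⟩ := exists_eq_smul_of_commute hirr
    (LinearMap.adjoint S.toLinearMap ∘ₗ T.toLinearMap) fun g y => by
      refine ext_inner_left ℂ fun x => ?_
      rw [← key, T.isIntertwining, ← inner_conj_symm, inner_apply_left hτ, inner_conj_symm,
        ← S.isIntertwining, key, ← inner_conj_symm, ← inner_conj_symm x]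
      congr 1
      conv_rhs => rw [inner_apply_left hβ]
  refine ⟨c, fun x y => ?_⟩
  rw [key, hc, inner_smul_right]

/-- The multiplicity space of an irreducible unitary representation `β` in a unitary
representation `τ`, as a Hilbert space. -/
theorem exists_multiplicity_space {τ : Representation ℂ G H} {β : Representation ℂ G B}
    (hτ : ∀ g x y, inner ℂ (τ g x) (τ g y) = inner ℂ x y)
    (hβ : ∀ g x y, inner ℂ (β g x) (β g y) = inner ℂ x y) (hirr : β.IsIrreducible) :
    ∃ (m : ℕ) (e : EuclideanSpace ℂ (Fin m) ≃ₗ[ℂ] β.IntertwiningMap τ),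
      ∀ a a' b b', inner ℂ (e a b) (e a' b') = inner ℂ a a' * inner ℂ b b' := by
  have := nontrivial_of_isIrreducible hirr
  obtain ⟨b₀, hb₀⟩ := exists_norm_eq B (c := 1) zero_le_one
  have hb₁ : inner ℂ b₀ b₀ = (1 : ℂ) := by simp [inner_self_eq_norm_sq_to_K, hb₀]
  have key : ∀ (S T : β.IntertwiningMap τ) x y,
      inner ℂ (S x) (T y) = inner ℂ (S b₀) (T b₀) * inner ℂ x y := fun S T x y => by
    obtain ⟨c, hc⟩ := exists_inner_eq_mul_inner hτ hβ hirr S T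
    rw [hc, hc, hb₁, mul_one]
  -- Evaluation at a unit vector reads off the Schur scalar as `⟨S b₀, T b₀⟩`, so the inner product
  -- of `H` restricted to the range of `ev` is the one wanted on the multiplicity space.
  let ev : β.IntertwiningMap τ →ₗ[ℂ] H :=
    { toFun := fun T => T b₀
      map_add' := fun _ _ => rfl
      map_smul' := fun _ _ => rfl }
  have hev : Function.Injective ev := by
    rw [injective_iff_map_eq_zero]
    intro T hT
    refine Representation.IntertwiningMap.ext (LinearMap.ext fun x => ?_)
    have hT' : T b₀ = 0 := hT
    have := key T T x x
    rw [hT', inner_zero_left, zero_mul, inner_self_eq_zero] at this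
    exact this
  let r := (stdOrthonormalBasis ℂ (LinearMap.range ev)).repr
  refine ⟨_, r.symm.toLinearEquiv.trans (LinearEquiv.ofInjective ev hev).symm, ?_⟩
  intro a a' b b'
  have hr : ∀ a, ((LinearEquiv.ofInjective ev hev).symm (r.symm a)) b₀ = (r.symm a : H) := fun a =>
    congrArg Subtype.val ((LinearEquiv.ofInjective ev hev).apply_symm_apply (r.symm a))
  simp only [LinearEquiv.trans_apply, LinearIsometryEquiv.coe_toLinearEquiv]
  rw [key, hr, hr, ← Submodule.coe_inner, LinearIsometryEquiv.inner_map_map]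

/-- An irreducible representation which occurs in a unitary representation has a unitary model on a
Euclidean space. -/
theorem exists_isometric_model [Fintype G] {τ : Representation ℂ G H}
    {n : ℕ} {σ : Representation ℂ G (Fin n → ℂ)} (hσ : σ.IsIrreducible)
    (h : charInner σ.character τ.character ≠ 0) :
    ∃ (k : ℕ) (β : Representation ℂ G (EuclideanSpace ℂ (Fin k)))
      (J : EuclideanSpace ℂ (Fin k) →ₗᵢ[ℂ] H),
      β.IsIrreducible ∧ β.character = σ.character ∧ ∀ g b, J (β g b) = τ g (J b) := by
  have : Invertible (Nat.card G : ℂ) := invertibleOfNonzero (by simp)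
  -- The scalar product of the characters is the dimension of `Hom_G(σ, τ)`, so a nonzero
  -- intertwiner exists. It embeds `σ`, and its range inherits the inner product of `H`.
  have h₁ : (Module.finrank ℂ (σ.IntertwiningMap τ) : ℂ) ≠ 0 := by
    rw [← Representation.card_inv_mul_sum_char_mul_char_eq_finrank]
    convert h using 1
    rw [charInner, Nat.card_eq_fintype_card]
    congr 1
    refine Fintype.sum_equiv (Equiv.inv G) _ _ fun g => ?_
    simp [mul_comm]
  have : Nontrivial (σ.IntertwiningMap τ) := by
    rw [← Module.finrank_pos_iff (R := ℂ)]
    exact Nat.pos_of_ne_zero (by exact_mod_cast h₁)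
  obtain ⟨T, hT⟩ := exists_ne (0 : σ.IntertwiningMap τ)
  have hinj : Function.Injective T.toLinearMap :=
    (Representation.IsIrreducible.injective_or_eq_zero T).resolve_right hT
  let r := (stdOrthonormalBasis ℂ (LinearMap.range T.toLinearMap)).repr
  let u := (LinearEquiv.ofInjective T.toLinearMap hinj).trans r.toLinearEquiv
  let β : Representation ℂ G (EuclideanSpace ℂ (Fin _)) := conjRepresentation σ u
  have hβ : ∀ g b, β g b = u (σ g (u.symm b)) := fun g b => rfl
  let φ : σ.Equiv β := .mk u fun g => LinearMap.ext fun v => by simp [hβ]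
  refine ⟨_, β, (Submodule.subtypeₗᵢ _).comp r.symm.toLinearIsometry,
    isIrreducible_of_linearEquiv hσ u (fun g v => by simp [hβ]), (Representation.char_iso φ).symm, fun g b => ?_⟩
  have hJ : ∀ b, (r.symm b : H) = T (u.symm b) := fun b =>
    (congrArg Subtype.val
      ((LinearEquiv.ofInjective T.toLinearMap hinj).apply_symm_apply (r.symm b))).symm
  change (r.symm (β g b) : H) = τ g (r.symm b : H)
  rw [hJ, hJ, hβ, LinearEquiv.symm_apply_apply, T.isIntertwining]

omit [FiniteDimensional ℂ H] [FiniteDimensional ℂ B] in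
/-- A family of maps `B → H` indexed by `A` that is multiplicative for inner products yields an
isometry `A ⊗ B → H`. -/
theorem exists_tensor_isometry {A : Type*} [NormedAddCommGroup A] [InnerProductSpace ℂ A]
    (f : A →ₗ[ℂ] B →ₗ[ℂ] H)
    (hf : ∀ a a' b b', inner ℂ (f a b) (f a' b') = inner ℂ a a' * inner ℂ b b') :
    ∃ F : A ⊗[ℂ] B →ₗᵢ[ℂ] H, ∀ a b, F (a ⊗ₜ b) = f a b := by
  refine ⟨(TensorProduct.lift f).isometryOfInner fun x y => ?_, fun a b => ?_⟩
  · induction x with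
    | zero => simp
    | add x x' hx hx' => rw [map_add, inner_add_left, inner_add_left, hx, hx']
    | tmul a b =>
      induction y with
      | zero => simp
      | add y y' hy hy' => rw [map_add, inner_add_right, inner_add_right, hy, hy']
      | tmul a' b' => simp [hf]
  · simp

end Unitary

open scoped commutatorElement

/-! ### Characters and central elements. -/

section Characters

variable {G V : Type*} [Group G] [AddCommGroup V] [Module ℂ V] {σ : Representation ℂ G V}

theorem character_mul_of_apply_eq_smul {c : G} {ω : ℂ} (h : ∀ v, σ c v = ω • v) (g : G) :
    σ.character (c * g) = ω * σ.character g := by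
  have : σ c = ω • 1 := LinearMap.ext h
  rw [Representation.character, map_mul, this, smul_mul_assoc, one_mul, map_smul, smul_eq_mul]
  rfl

theorem character_of_apply_eq_smul [FiniteDimensional ℂ V] {c : G} {ω : ℂ}
    (h : ∀ v, σ c v = ω • v) : σ.character c = ω * Module.finrank ℂ V := by
  rw [← mul_one c, character_mul_of_apply_eq_smul h, Representation.char_one]

/-- `⁅m, n⁆ n` is conjugate to `n`, so the character value at `n` equals `ω` times itself. -/
theorem character_eq_zero_of_commutator {m n : G} {ω : ℂ} (h : ∀ v, σ ⁅m, n⁆ v = ω • v)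
    (hω : ω ≠ 1) : σ.character n = 0 := by
  have h₁ : σ.character (⁅m, n⁆ * n) = σ.character n := by
    rw [commutatorElement_def, inv_mul_cancel_right]
    rw [Representation.char_mul_comm, inv_mul_cancel_left]
  rw [character_mul_of_apply_eq_smul h] at h₁
  have : (ω - 1) * σ.character n = 0 := by linear_combination h₁
  exact (mul_eq_zero.1 this).resolve_left (sub_ne_zero.2 hω)

theorem mul_eq_one_of_apply_eq_smul [Nontrivial V] {c : G} {ω ω' : ℂ} (h : ∀ v, σ c v = ω • v)
    (h' : ∀ v, σ c⁻¹ v = ω' • v) : ω' * ω = 1 := by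
  obtain ⟨v, hv⟩ := exists_ne (0 : V)
  have h₁ := σ.inv_self_apply c v
  rw [h, map_smul, h', smul_smul] at h₁
  have h₂ : (ω * ω' - 1) • v = 0 := by rw [sub_smul, h₁, one_smul, sub_self]
  linear_combination (smul_eq_zero.1 h₂).resolve_right hv

variable [FiniteDimensional ℂ V]

theorem sum_character_mul_character_inv [Fintype G] (hσ : σ.IsIrreducible) :
    ∑ g : G, σ.character g * σ.character g⁻¹ = Fintype.card G := by
  have : Invertible (Nat.card G : ℂ) := invertibleOfNonzero (by simp)
  have h := Representation.card_inv_mul_sum_char_mul_char_eq_finrank σ σ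
  rw [Representation.IsIrreducible.finrank_intertwiningMap_self, Nat.cast_one,
    inv_mul_eq_one₀ (by simp), Nat.card_eq_fintype_card] at h
  exact h.symm

/-- In `∑ χ(g) χ(g⁻¹) = |G|` only the center contributes. Each central term is `χ(1)²`, because the
scalars of `g` and `g⁻¹` cancel. -/
theorem finrank_eq_sqrt_index_center [Fintype G] (hσ : σ.IsIrreducible)
    (hvan : ∀ g, g ∉ Subgroup.center G → σ.character g = 0) :
    (Module.finrank ℂ V : ℝ) = Real.sqrt ((Subgroup.center G).index : ℝ) := by
  classical
  have := nontrivial_of_isIrreducible hσ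
  have hsum := sum_character_mul_character_inv hσ
  have hterm : ∀ g, σ.character g * σ.character g⁻¹ =
      if g ∈ Subgroup.center G then (Module.finrank ℂ V : ℂ) ^ 2 else 0 := fun g => by
    split_ifs with hg
    · obtain ⟨ω, h⟩ := exists_eq_smul_of_mem_center hσ hg
      obtain ⟨ω', h'⟩ := exists_eq_smul_of_mem_center hσ (inv_mem hg)
      rw [character_of_apply_eq_smul h, character_of_apply_eq_smul h']
      linear_combination (Module.finrank ℂ V : ℂ) ^ 2 * mul_eq_one_of_apply_eq_smul h h'
    · rw [hvan g hg, zero_mul]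
  simp_rw [hterm] at hsum
  rw [← Finset.sum_filter, Finset.sum_const, nsmul_eq_mul] at hsum
  have hcard : (Finset.univ.filter (· ∈ Subgroup.center G)).card =
      Nat.card (Subgroup.center G) := by
    rw [Nat.card_eq_fintype_card, Fintype.card_subtype]
  rw [hcard, ← Nat.card_eq_fintype_card, ← (Subgroup.center G).card_mul_index] at hsum
  have hpos : Nat.card (Subgroup.center G) ≠ 0 := Nat.card_pos.ne'
  have : Module.finrank ℂ V ^ 2 = (Subgroup.center G).index :=
    Nat.eq_of_mul_eq_mul_left (Nat.pos_of_ne_zero hpos) (by exact_mod_cast hsum)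
  rw [← this, Nat.cast_pow, Real.sqrt_sq (Nat.cast_nonneg _)]

end Characters

/-! ### Vanishing of characters off the center, and the inertia group. -/

section ErrorRepresentation

variable {E H B : Type*} [Group E] [NormedAddCommGroup H] [InnerProductSpace ℂ H]
  [FiniteDimensional ℂ H] [NormedAddCommGroup B] [InnerProductSpace ℂ B] [FiniteDimensional ℂ B]
  {ρ : Representation ℂ E H}

omit [FiniteDimensional ℂ H] in
theorem eq_one_of_forall_apply_eq (hρ : IsErrorRepresentation ρ) {g : E} (h : ∀ v, ρ g v = v) :
    g = 1 :=
  hρ.faithful (by rw [map_one]; exact LinearMap.ext h)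

theorem eq_one_of_apply_eq (hρ : IsErrorRepresentation ρ) {z : E} (hz : z ∈ Subgroup.center E)
    {v : H} (hv : v ≠ 0) (h : ρ z v = v) : z = 1 := by
  obtain ⟨ω, hω⟩ := exists_eq_smul_of_mem_center hρ.irreducible hz
  refine eq_one_of_forall_apply_eq hρ fun w => ?_
  have : (ω - 1) • v = 0 := by rw [sub_smul, ← hω, h, one_smul, sub_self]
  rw [hω, sub_eq_zero.1 ((smul_eq_zero.1 this).resolve_right hv), one_smul]

theorem commutatorElement_mem_center (hE : commutator E ≤ Subgroup.center E) (g h : E) :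
    ⁅g, h⁆ ∈ Subgroup.center E :=
  hE (Subgroup.commutator_mem_commutator (Subgroup.mem_top g) (Subgroup.mem_top h))

theorem character_eq_zero_of_notMem_center (hE : commutator E ≤ Subgroup.center E)
    (hρ : IsErrorRepresentation ρ) {g : E} (hg : g ∉ Subgroup.center E) : ρ.character g = 0 := by
  rw [Subgroup.mem_center_iff] at hg
  push Not at hg
  obtain ⟨m, hm⟩ := hg
  obtain ⟨ω, hω⟩ := exists_eq_smul_of_mem_center hρ.irreducible (commutatorElement_mem_center hE m g)
  refine character_eq_zero_of_commutator hω fun h => hm ?_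
  rw [← commutatorElement_eq_one_iff_mul_comm]
  exact eq_one_of_forall_apply_eq hρ fun v => by rw [hω, h, one_smul]

variable {N : Subgroup E} {β : Representation ℂ N B} {J : B →ₗᵢ[ℂ] H}

omit [FiniteDimensional ℂ B] in
-- The embedding `J` makes a central element of `E` lying in `N` act on `B` by the same scalar as on
-- `H`. Thus faithfulness of `ρ` can be used on `B`.
theorem exists_central_scalar (hρ : IsErrorRepresentation ρ)
    (hJ : ∀ n b, J (β n b) = ρ n (J b)) {c : N} (hc : (c : E) ∈ Subgroup.center E) :
    ∃ ω : ℂ, (∀ v, ρ c v = ω • v) ∧ ∀ b, β c b = ω • b := by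
  obtain ⟨ω, hω⟩ := exists_eq_smul_of_mem_center hρ.irreducible hc
  refine ⟨ω, hω, fun b => J.injective ?_⟩
  rw [hJ, hω, map_smul]

omit [FiniteDimensional ℂ B] in
theorem restricted_character_eq_zero (hE : commutator E ≤ Subgroup.center E)
    (hρ : IsErrorRepresentation ρ) (hJ : ∀ n b, J (β n b) = ρ n (J b)) {n : N}
    (hn : n ∉ Subgroup.center N) : β.character n = 0 := by
  rw [Subgroup.mem_center_iff] at hn
  push Not at hn
  obtain ⟨m, hm⟩ := hn
  obtain ⟨ω, hω, hω'⟩ := exists_central_scalar hρ hJ (c := ⁅m, n⁆)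
    (commutatorElement_mem_center hE m n)
  refine character_eq_zero_of_commutator hω' fun h => hm ?_
  rw [← commutatorElement_eq_one_iff_mul_comm]
  exact Subtype.ext (eq_one_of_forall_apply_eq hρ fun v => by rw [hω, h, one_smul])

theorem mem_centralizerOfCenter_iff {g : E} :
    g ∈ centralizerOfCenter N ↔ ∀ z ∈ Subgroup.center N, ⁅g, (z : E)⁆ = 1 := by
  rw [centralizerOfCenter, Subgroup.mem_centralizer_iff]
  constructor
  · intro h z hz
    exact commutatorElement_eq_one_iff_mul_comm.2 (h z ⟨z, hz, rfl⟩).symm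
  · rintro h _ ⟨z, hz, rfl⟩
    exact (commutatorElement_eq_one_iff_mul_comm.1 (h z hz)).symm

theorem inertiaGroup_eq_centralizerOfCenter [N.Normal] (hE : commutator E ≤ Subgroup.center E)
    (hρ : IsErrorRepresentation ρ) (hJ : ∀ n b, J (β n b) = ρ n (J b)) (hβ : β.IsIrreducible) :
    inertiaGroup N β.character = centralizerOfCenter N := by
  have := nontrivial_of_isIrreducible hβ
  ext g
  rw [mem_centralizerOfCenter_iff]
  -- `g x g⁻¹ = ⁅g, x⁆ x`, and by normality the commutator lies in `N` as well as in `Z(E)`.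
  have hconj : ∀ x : N, ∃ ω : ℂ, (∀ v, ρ ⁅g, (x : E)⁆ v = ω • v) ∧
      β.character (MulAut.conjNormal g x) = ω * β.character x := fun x => by
    have hmem : ⁅g, (x : E)⁆ ∈ N := by
      rw [commutatorElement_def]
      exact N.mul_mem (Subgroup.Normal.conj_mem inferInstance _ x.2 g) (N.inv_mem x.2)
    obtain ⟨ω, hω, hω'⟩ := exists_central_scalar hρ hJ (c := ⟨⁅g, (x : E)⁆, hmem⟩)
      (commutatorElement_mem_center hE g x)
    refine ⟨ω, hω, ?_⟩
    rw [← character_mul_of_apply_eq_smul hω']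
    congr 1
    ext
    simp [commutatorElement_def]
  constructor
  · intro hg z hz
    obtain ⟨ω, hω, hχ⟩ := hconj z
    rw [show β.character (MulAut.conjNormal g z) = β.character z from hg z] at hχ
    obtain ⟨θ, hθ⟩ := exists_eq_smul_of_mem_center hβ hz
    -- On `Z(N)` the character is a nonzero scalar times the degree, so invariance under `g` can be
    -- cancelled to `ω = 1`.
    have hne : β.character z ≠ 0 := by
      rw [character_of_apply_eq_smul hθ]
      refine mul_ne_zero (fun h => ?_) (by exact_mod_cast Module.finrank_pos.ne')
      obtain ⟨v, hv⟩ := exists_ne (0 : B)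
      exact apply_ne_zero (σ := β) z hv (by rw [hθ, h, zero_smul])
    have hone : ω = 1 := mul_right_cancel₀ hne (by rw [← hχ, one_mul])
    exact eq_one_of_forall_apply_eq hρ fun v => by rw [hω, hone, one_smul]
  · intro hg x
    obtain ⟨ω, hω, hχ⟩ := hconj x
    by_cases hx : x ∈ Subgroup.center N
    · congr 1
      ext
      rw [MulAut.conjNormal_apply, mul_inv_eq_iff_eq_mul]
      exact commutatorElement_eq_one_iff_mul_comm.1 (hg x hx)
    · rw [hχ, restricted_character_eq_zero hE hρ hJ hx, mul_zero]

end ErrorRepresentation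

/-! ### The operator `P`, and how errors move the code. -/

section Projector

variable {E H B : Type*} [Group E] [NormedAddCommGroup H] [InnerProductSpace ℂ H]
  [FiniteDimensional ℂ H] [NormedAddCommGroup B] [InnerProductSpace ℂ B] [FiniteDimensional ℂ B]
  {ρ : Representation ℂ E H} {N : Subgroup E} [Fintype N] {β : Representation ℂ N B}
  {J : B →ₗᵢ[ℂ] H}

omit [FiniteDimensional ℂ H] in
theorem projector_apply (χ : N → ℂ) (v : H) :
    projector ρ N χ v = (χ 1 / (Fintype.card N : ℂ)) • ∑ n : N, χ n⁻¹ • ρ (n : E) v := by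
  simp [projector]

omit [FiniteDimensional ℂ H] in
-- The class sum `∑ χ(n⁻¹) β(n)` is a scalar by Schur. Its trace `|N|` shows that the factor `χ(1) /
-- |N|` normalises this scalar to 1.
theorem projector_apply_intertwiningMap (hβ : β.IsIrreducible)
    (T : β.IntertwiningMap (MonoidHom.comp ρ N.subtype : Representation ℂ N H)) (b : B) :
    projector ρ N β.character (T b) = T b := by
  have := nontrivial_of_isIrreducible hβ
  let f : B →ₗ[ℂ] B := ∑ n : N, β.character n⁻¹ • β n
  have hf : ∀ b, f b = ∑ n : N, β.character n⁻¹ • β n b := fun b => by simp [f]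
  obtain ⟨c, hc⟩ := exists_eq_smul_of_commute hβ f fun g b => by
    rw [hf, hf, map_sum]
    refine Fintype.sum_equiv (MulAut.conj g⁻¹).toEquiv _ _ fun n => ?_
    rw [map_smul]
    congr 1
    · simp only [MulEquiv.toEquiv_eq_coe, MulEquiv.coe_toEquiv, MulAut.conj_apply, inv_inv]
      rw [show (g⁻¹ * n * g)⁻¹ = g⁻¹ * n⁻¹ * g⁻¹⁻¹ by group, Representation.char_conj]
    · simp only [← Module.End.mul_apply, ← map_mul]
      simp [mul_assoc]
  have htr : c * Module.finrank ℂ B = Fintype.card N := by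
    rw [← sum_character_mul_character_inv hβ]
    have h₁ : f = c • 1 := LinearMap.ext hc
    have h₂ := congrArg (LinearMap.trace ℂ B) h₁
    rw [map_smul, LinearMap.trace_one, smul_eq_mul] at h₂
    rw [← h₂]
    simp only [f, map_sum, map_smul, smul_eq_mul]
    exact Finset.sum_congr rfl fun n _ => mul_comm _ _
  have hT : ∀ n : N, ρ n (T b) = T (β n b) := fun n => (T.isIntertwining _ _ n b).symm
  rw [projector_apply]
  simp_rw [hT]
  have hTf : ∑ n : N, β.character n⁻¹ • T (β n b) = T (f b) := by simp [hf]
  rw [hTf, hc, map_smul, smul_smul, Representation.char_one, div_mul_eq_mul_div, mul_comm, htr,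
    div_self (by simp), one_smul]

omit [FiniteDimensional ℂ H] [FiniteDimensional ℂ B] in
theorem projector_mul_center {z : N} {θ : ℂ}
    (hθ : ∀ b, β z b = θ • b) (v : H) :
    projector ρ N β.character (ρ z v) = θ • projector ρ N β.character v := by
  rw [projector_apply, projector_apply, smul_comm θ]
  congr 1
  rw [Finset.smul_sum]
  refine Fintype.sum_equiv (Equiv.mulRight z) _ _ fun n => ?_
  rw [smul_smul, ← character_mul_of_apply_eq_smul hθ]
  simp [map_mul]

omit [FiniteDimensional ℂ H] [FiniteDimensional ℂ B] in
theorem center_mul_projector {z : N} (hz : z ∈ Subgroup.center N) {θ : ℂ}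
    (hθ : ∀ b, β z b = θ • b) (v : H) :
    ρ z (projector ρ N β.character v) = θ • projector ρ N β.character v := by
  rw [← projector_mul_center hθ, projector_apply, projector_apply, map_smul, map_sum]
  congr 1
  refine Finset.sum_congr rfl fun n _ => ?_
  rw [map_smul, ← Module.End.mul_apply, ← Module.End.mul_apply, ← map_mul, ← map_mul]
  have := congrArg Subtype.val (Subgroup.mem_center_iff.1 hz n)
  rw [Subgroup.coe_mul, Subgroup.coe_mul] at this
  rw [this]

omit [Fintype N] in
theorem exists_center_element (hE : commutator E ≤ Subgroup.center E)
    (hρ : IsErrorRepresentation ρ) {g : E} (hg : g ∉ centralizerOfCenter N) :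
    ∃ z ∈ Subgroup.center N, ∃ ω : ℂ, ω ≠ 1 ∧ ∀ v, ρ z (ρ g v) = ω • ρ g (ρ z v) := by
  rw [mem_centralizerOfCenter_iff] at hg
  push Not at hg
  obtain ⟨z, hz, hgz⟩ := hg
  obtain ⟨ω, hω⟩ := exists_eq_smul_of_mem_center hρ.irreducible
    (commutatorElement_mem_center hE (z : E) g)
  refine ⟨z, hz, ω, fun h => hgz ?_, fun v => ?_⟩
  · rw [commutatorElement_eq_one_iff_mul_comm]
    refine (commutatorElement_eq_one_iff_mul_comm.1 ?_).symm
    exact eq_one_of_forall_apply_eq hρ fun v => by rw [hω, h, one_smul]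
  · rw [← hω]
    simp only [← Module.End.mul_apply, ← map_mul]
    simp [commutatorElement_def, mul_assoc]

omit [FiniteDimensional ℂ B] [Fintype N] in
theorem scalar_ne_zero (hβ : β.IsIrreducible) {z : N} {θ : ℂ} (hθ : ∀ b, β z b = θ • b) :
    θ ≠ 0 := by
  have := nontrivial_of_isIrreducible hβ
  obtain ⟨v, hv⟩ := exists_ne (0 : B)
  exact fun h => apply_ne_zero (σ := β) z hv (by rw [hθ, h, zero_smul])

/-- Outside of the inertia group an error maps the code into the kernel of the projector. -/
theorem projector_apply_of_notMem (hE : commutator E ≤ Subgroup.center E)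
    (hρ : IsErrorRepresentation ρ) (hβ : β.IsIrreducible) {g : E}
    (hg : g ∉ centralizerOfCenter N) (v : H) :
    projector ρ N β.character (ρ g (projector ρ N β.character v)) = 0 := by
  obtain ⟨z, hz, ω, hω, hzg⟩ := exists_center_element hE hρ hg
  obtain ⟨θ, hθ⟩ := exists_eq_smul_of_mem_center hβ hz
  -- Moving `z` past `g` onto the code gives `ω θ`, absorbing it into the outer `P` gives `θ`, and
  -- `ω ≠ 1`.
  have h := projector_mul_center (ρ := ρ) hθ (ρ g (projector ρ N β.character v))
  rw [hzg, center_mul_projector hz hθ, map_smul, map_smul, map_smul, smul_smul, ← sub_eq_zero,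
    ← sub_smul] at h
  refine (smul_eq_zero.1 h).resolve_left ?_
  rw [← sub_one_mul]
  exact mul_ne_zero (sub_ne_zero.2 hω) (scalar_ne_zero hβ hθ)

/-- Outside of the inertia group an error maps the code into its orthogonal complement. -/
theorem apply_mem_orthogonal_of_notMem (hE : commutator E ≤ Subgroup.center E)
    (hρ : IsErrorRepresentation ρ) (hβ : β.IsIrreducible) {g : E}
    (hg : g ∉ centralizerOfCenter N) {v : H} (hv : v ∈ code ρ N β.character) :
    ρ g v ∈ (code ρ N β.character)ᗮ := by
  obtain ⟨v, rfl⟩ := hv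
  rintro _ ⟨u, rfl⟩
  obtain ⟨z, hz, ω, hω, hzg⟩ := exists_center_element hE hρ hg
  obtain ⟨θ, hθ⟩ := exists_eq_smul_of_mem_center hβ hz
  obtain ⟨θ', hθ'⟩ := exists_eq_smul_of_mem_center hβ (inv_mem hz)
  have := nontrivial_of_isIrreducible hβ
  have hmul := mul_eq_one_of_apply_eq_smul hθ hθ'
  set x := projector ρ N β.character u
  set y := projector ρ N β.character v with hy
  -- `z` acts on `x` by `θ` and on `ρ g y` by `ω θ`. Eigenvectors of a unitary operator for distinct
  -- eigenvalues are orthogonal; `h₂` supplies `|θ| = 1`.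
  have h₁ := hρ.unitary z x (ρ g y)
  have h₂ := hρ.unitary z x x
  rw [hzg, center_mul_projector hz hθ, center_mul_projector hz hθ, map_smul, inner_smul_left,
    inner_smul_right, inner_smul_right] at h₁
  rw [center_mul_projector hz hθ, inner_smul_left, inner_smul_right] at h₂
  by_cases hx : x = 0
  · rw [hx, inner_zero_left]
  · have hx' : inner ℂ x x ≠ (0 : ℂ) := fun h => hx (inner_self_eq_zero.1 h)
    have h₃ : (starRingEnd ℂ) θ * θ = 1 := mul_right_cancel₀ hx' (by linear_combination h₂)
    have h₄ : (ω - 1) * inner ℂ x (ρ g y) = 0 := by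
      linear_combination h₁ - ω * inner ℂ x (ρ g y) * h₃
    exact (mul_eq_zero.1 h₄).resolve_left (sub_ne_zero.2 hω)

/-- A nonzero subspace of the code that is invariant under the inertia group is the full code. -/
theorem code_le_of_invariant (hE : commutator E ≤ Subgroup.center E)
    (hρ : IsErrorRepresentation ρ) (hβ : β.IsIrreducible) {W : Submodule ℂ H} (hW : W ≠ ⊥)
    (hproj : ∀ w ∈ W, projector ρ N β.character w = w)
    (hinv : ∀ g ∈ centralizerOfCenter N, ∀ w ∈ W, ρ g w ∈ W) : code ρ N β.character ≤ W := by
  -- The largest `E`-invariant subspace that `P` maps into `W`. It contains `W`, hence is all of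
  -- `H`.
  let U : Submodule ℂ H := ⨅ g : E, W.comap (projector ρ N β.character ∘ₗ ρ g)
  have hU : ∀ v, v ∈ U ↔ ∀ g, projector ρ N β.character (ρ g v) ∈ W := fun v => by simp [U]
  have hWU : W ≤ U := fun w hw => (hU w).2 fun g => by
    by_cases hg : g ∈ centralizerOfCenter N
    · rw [hproj _ (hinv g hg w hw)]
      exact hinv g hg w hw
    · rw [← hproj w hw, projector_apply_of_notMem hE hρ hβ hg]
      exact W.zero_mem
  have htop : U = ⊤ := by
    refine (eq_bot_or_eq_top_of_invariant hρ.irreducible U fun g v hv => ?_).resolve_left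
      fun h => hW (le_bot_iff.1 (h ▸ hWU))
    rw [hU] at hv ⊢
    intro h
    rw [← Module.End.mul_apply (ρ h), ← map_mul]
    exact hv _
  rintro _ ⟨v, rfl⟩
  have := (hU v).1 (htop ▸ Submodule.mem_top) 1
  rwa [map_one, Module.End.one_apply] at this

/-- The character of `ρ` vanishes off `Z(E)`. On `Z(E) ∩ N` the scalars of `n⁻¹` on `B` and of `n`
on `H` cancel, so every surviving term is `dim B · dim H`. -/
theorem trace_projector [N.Normal] (hE : commutator E ≤ Subgroup.center E)
    (hρ : IsErrorRepresentation ρ) (hJ : ∀ n b, J (β n b) = ρ n (J b)) :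
    LinearMap.trace ℂ H (projector ρ N β.character) =
      (Module.finrank ℂ B : ℂ) ^ 2 * Module.finrank ℂ H *
        Nat.card (Subgroup.center E ⊓ N : Subgroup E) / Nat.card N := by
  classical
  have := nontrivial_of_isIrreducible hρ.irreducible
  have hterm : ∀ n : N, β.character n⁻¹ * ρ.character n =
      if (n : E) ∈ Subgroup.center E then (Module.finrank ℂ B : ℂ) * Module.finrank ℂ H else 0 := by
    intro n
    split_ifs with hn
    · obtain ⟨ω, h, -⟩ := exists_central_scalar hρ hJ hn
      obtain ⟨ω', h₁, h₂⟩ := exists_central_scalar hρ hJ (c := n⁻¹) (inv_mem hn)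
      rw [character_of_apply_eq_smul h, character_of_apply_eq_smul h₂]
      linear_combination (Module.finrank ℂ B : ℂ) * Module.finrank ℂ H *
        mul_eq_one_of_apply_eq_smul h h₁
    · rw [character_eq_zero_of_notMem_center hE hρ hn, mul_zero]
  have hcard : (Finset.univ.filter fun n : N => (n : E) ∈ Subgroup.center E).card =
      Nat.card (Subgroup.center E ⊓ N : Subgroup E) := by
    rw [← Fintype.card_subtype, ← Nat.card_eq_fintype_card]
    exact Nat.card_congr
      { toFun := fun x => ⟨x.1, x.2, x.1.2⟩
        invFun := fun x => ⟨⟨x.1, x.2.2⟩, x.2.1⟩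
        left_inv := fun _ => rfl
        right_inv := fun _ => rfl }
  have hsum : LinearMap.trace ℂ H (projector ρ N β.character) =
      β.character 1 / Fintype.card N * ∑ n : N, β.character n⁻¹ * ρ.character n := by
    simp [projector, Representation.character]
  rw [hsum]
  simp_rw [hterm]
  rw [← Finset.sum_filter, Finset.sum_const, nsmul_eq_mul, hcard, Representation.char_one,
    Nat.card_eq_fintype_card (α := N)]
  ring

end Projector

/-! ### The action of `L` on `Hom_N(B, H)`. -/

section Multiplicity

variable {E H B : Type*} [Group E] [NormedAddCommGroup H] [InnerProductSpace ℂ H]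
  [NormedAddCommGroup B] [InnerProductSpace ℂ B] {ρ : Representation ℂ E H} {L N : Subgroup E}
  {β : Representation ℂ N B}

theorem mul_comm_of_commutator_eq_bot (hLN : ⁅L, N⁆ = ⊥) (l : L) (n : N) :
    (l : E) * n = n * l :=
  commutatorElement_eq_one_iff_mul_comm.1
    ((Subgroup.mem_bot).1 (hLN ▸ Subgroup.commutator_mem_commutator l.2 n.2))

/-- The action of a subgroup `L` commuting with `N` on the space of intertwining maps. -/
def multiplicityRepresentation (ρ : Representation ℂ E H) (β : Representation ℂ N B)
    (hLN : ⁅L, N⁆ = ⊥) : Representation ℂ L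
      (β.IntertwiningMap (MonoidHom.comp ρ N.subtype : Representation ℂ N H)) where
  toFun l :=
    { toFun := fun T => ⟨ρ l ∘ₗ T.toLinearMap, fun n => LinearMap.ext fun b => by
        change ρ l (T (β n b)) = ρ n (ρ l (T b))
        have hT : T (β n b) = ρ n (T b) := T.isIntertwining _ _ n b
        rw [hT, ← Module.End.mul_apply, ← Module.End.mul_apply, ← map_mul, ← map_mul,
          mul_comm_of_commutator_eq_bot hLN]⟩
      map_add' := fun S T => Representation.IntertwiningMap.ext
        (LinearMap.ext fun b => map_add (ρ l) (S b) (T b))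
      map_smul' := fun c T => Representation.IntertwiningMap.ext
        (LinearMap.ext fun b => map_smul (ρ l) c (T b)) }
  map_one' := LinearMap.ext fun T => Representation.IntertwiningMap.ext (LinearMap.ext fun b => by
    change ρ (1 : E) (T b) = T b
    rw [map_one, Module.End.one_apply])
  map_mul' l l' := LinearMap.ext fun T =>
    Representation.IntertwiningMap.ext (LinearMap.ext fun b => by
      change ρ (l * l' : E) (T b) = ρ l (ρ l' (T b))
      rw [map_mul, Module.End.mul_apply])

theorem multiplicityRepresentation_apply (hLN : ⁅L, N⁆ = ⊥) (l : L)
    (T : β.IntertwiningMap (MonoidHom.comp ρ N.subtype : Representation ℂ N H)) (b : B) :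
    multiplicityRepresentation ρ β hLN l T b = ρ l (T b) :=
  rfl

end Multiplicity

/-! ### The code as `A ⊗ B`. -/

section TensorDecomposition

variable {E H A B : Type*} [Group E] [NormedAddCommGroup H] [InnerProductSpace ℂ H]
  [FiniteDimensional ℂ H] [NormedAddCommGroup A] [InnerProductSpace ℂ A] [FiniteDimensional ℂ A]
  [NormedAddCommGroup B] [InnerProductSpace ℂ B] [FiniteDimensional ℂ B]
  {ρ : Representation ℂ E H} {L N : Subgroup E} [Fintype N]
  {α : Representation ℂ L A} {β : Representation ℂ N B} {f : A →ₗ[ℂ] B →ₗ[ℂ] H}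

omit [FiniteDimensional ℂ A] in
/-- An `L`-invariant subspace `A'` of `A` yields an `L N`-invariant subspace `A' ⊗ B`, and hence all
of the code. -/
theorem code_le_map₂ (hE : commutator E ≤ Subgroup.center E)
    (hρ : IsErrorRepresentation ρ) (hβ : β.IsIrreducible)
    (hL : (centralizerOfCenter N : Set E) = (L : Set E) * (N : Set E))
    (hf : ∀ a a' b b', inner ℂ (f a b) (f a' b') = inner ℂ a a' * inner ℂ b b')
    (hact : ∀ (l : L) (n : N) a b, ρ (l * n : E) (f a b) = f (α l a) (β n b))
    (hproj : ∀ a b, projector ρ N β.character (f a b) = f a b) {A' : Submodule ℂ A} (hA' : A' ≠ ⊥)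
    (hinv : ∀ l, ∀ a ∈ A', α l a ∈ A') :
    code ρ N β.character ≤ Submodule.map₂ f A' ⊤ := by
  have := nontrivial_of_isIrreducible hβ
  refine code_le_of_invariant hE hρ hβ ?_ ?_ ?_
  · obtain ⟨a, ha, ha0⟩ := Submodule.exists_mem_ne_zero_of_ne_bot hA'
    obtain ⟨b, hb⟩ := exists_ne (0 : B)
    intro h
    have hab : f a b ∈ Submodule.map₂ f A' ⊤ := Submodule.apply_mem_map₂ f ha Submodule.mem_top
    rw [h, Submodule.mem_bot] at hab
    have := hf a a b b
    rw [hab, inner_zero_left, eq_comm, mul_eq_zero, inner_self_eq_zero, inner_self_eq_zero] at this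
    exact this.elim ha0 hb
  · have : Submodule.map₂ f A' ⊤ ≤ LinearMap.eqLocus (projector ρ N β.character) LinearMap.id :=
      Submodule.map₂_le.2 fun a _ b _ => hproj a b
    exact fun w hw => this hw
  · intro g hg
    obtain ⟨l, hl, n, hn, rfl⟩ : g ∈ (L : Set E) * (N : Set E) := hL ▸ hg
    have : Submodule.map₂ f A' ⊤ ≤ (Submodule.map₂ f A' ⊤).comap (ρ (l * n)) :=
      Submodule.map₂_le.2 fun a ha b _ => by
        rw [Submodule.mem_comap, hact ⟨l, hl⟩ ⟨n, hn⟩]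
        exact Submodule.apply_mem_map₂ f (hinv _ _ ha) Submodule.mem_top
    exact fun w hw => this hw

omit [FiniteDimensional ℂ H] [FiniteDimensional ℂ A] [FiniteDimensional ℂ B] in
theorem apply_mem_code (hproj : ∀ a b, projector ρ N β.character (f a b) = f a b) (a : A) (b : B) :
    f a b ∈ code ρ N β.character :=
  ⟨f a b, hproj a b⟩

/-- If `a ⊥ A'` with `A'` nonzero and invariant, then `a ⊗ b` lies in the code, hence in `A' ⊗ B`,
to which it is orthogonal. So `a = 0`. -/
theorem isIrreducible_of_code [Nontrivial A] (hE : commutator E ≤ Subgroup.center E)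
    (hρ : IsErrorRepresentation ρ) (hβ : β.IsIrreducible)
    (hL : (centralizerOfCenter N : Set E) = (L : Set E) * (N : Set E))
    (hf : ∀ a a' b b', inner ℂ (f a b) (f a' b') = inner ℂ a a' * inner ℂ b b')
    (hact : ∀ (l : L) (n : N) a b, ρ (l * n : E) (f a b) = f (α l a) (β n b))
    (hproj : ∀ a b, projector ρ N β.character (f a b) = f a b) : α.IsIrreducible := by
  have := nontrivial_of_isIrreducible hβ
  refine isIrreducible_of_invariant fun A' hinv => or_iff_not_imp_left.2 fun hA' => ?_
  have hle := code_le_map₂ hE hρ hβ hL hf hact hproj hA' hinv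
  rw [← Submodule.orthogonal_eq_bot_iff, eq_bot_iff]
  intro a ha
  obtain ⟨b, hb⟩ := exists_ne (0 : B)
  have horth : Submodule.map₂ f A' ⊤ ≤ (ℂ ∙ f a b)ᗮ := Submodule.map₂_le.2 fun a' ha' b' _ => by
    rw [Submodule.mem_orthogonal_singleton_iff_inner_right, hf,
      Submodule.inner_left_of_mem_orthogonal ha' ha, zero_mul]
  have h := horth (hle (apply_mem_code hproj a b))
  rw [Submodule.mem_orthogonal_singleton_iff_inner_right, hf, mul_eq_zero, inner_self_eq_zero,
    inner_self_eq_zero] at h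
  exact h.resolve_right hb

omit [FiniteDimensional ℂ A] in
theorem range_tensor_isometry_eq_code (hE : commutator E ≤ Subgroup.center E) [Nontrivial A]
    (hρ : IsErrorRepresentation ρ) (hβ : β.IsIrreducible)
    (hL : (centralizerOfCenter N : Set E) = (L : Set E) * (N : Set E))
    (hf : ∀ a a' b b', inner ℂ (f a b) (f a' b') = inner ℂ a a' * inner ℂ b b')
    (hact : ∀ (l : L) (n : N) a b, ρ (l * n : E) (f a b) = f (α l a) (β n b))
    (hproj : ∀ a b, projector ρ N β.character (f a b) = f a b)
    {F : A ⊗[ℂ] B →ₗᵢ[ℂ] H} (hF : ∀ a b, F (a ⊗ₜ b) = f a b) :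
    LinearMap.range F.toLinearMap = code ρ N β.character := by
  apply le_antisymm
  · rintro _ ⟨x, rfl⟩
    induction x with
    | zero => simp
    | add x y hx hy => rw [map_add]; exact add_mem hx hy
    | tmul a b =>
      rw [LinearIsometry.coe_toLinearMap, hF]
      exact apply_mem_code hproj a b
  · refine (code_le_map₂ hE hρ hβ hL hf hact hproj top_ne_bot fun _ _ _ => Submodule.mem_top).trans
      (Submodule.map₂_le.2 fun a _ b _ => ⟨a ⊗ₜ b, hF a b⟩)

end TensorDecomposition

/-! ### Which operators act as `1 ⊗ M`. -/

section Detection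

variable {E H A B : Type*} [Group E] [NormedAddCommGroup H] [InnerProductSpace ℂ H]
  [NormedAddCommGroup A] [InnerProductSpace ℂ A] [NormedAddCommGroup B] [InnerProductSpace ℂ B]
  {ρ : Representation ℂ E H} {L : Subgroup E} {α : Representation ℂ L A} {f : A →ₗ[ℂ] B →ₗ[ℂ] H}

/-- If `S ⊗ R = 1 ⊗ M` with `R` injective, then `S` is a scalar. -/
theorem exists_eq_smul_of_tensor_eq [Nontrivial B]
    (hf : ∀ a a' b b', inner ℂ (f a b) (f a' b') = inner ℂ a a' * inner ℂ b b')
    {S : A →ₗ[ℂ] A} {R M : B →ₗ[ℂ] B} (hR : ∀ b, b ≠ 0 → R b ≠ 0)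
    (h : ∀ a b, f (S a) (R b) = f a (M b)) : ∃ c : ℂ, ∀ a, S a = c • a := by
  obtain ⟨b, hb⟩ := exists_ne (0 : B)
  have hne : inner ℂ (R b) (R b) ≠ (0 : ℂ) := fun h => hR b hb (inner_self_eq_zero.1 h)
  -- The scalar results from pairing `S a ⊗ R b = a ⊗ M b` with `a' ⊗ R b`.
  refine ⟨inner ℂ (R b) (M b) / inner ℂ (R b) (R b), fun a => ext_inner_left ℂ fun a' => ?_⟩
  have h₁ := hf a' (S a) (R b) (R b)
  rw [h, hf] at h₁
  rw [inner_smul_right, div_mul_eq_mul_div, eq_div_iff hne, ← h₁, mul_comm]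

/-- As `α l` is a scalar, `l l'` and `l' l` agree on `a ⊗ b`, so `⁅l, l'⁆` fixes a nonzero vector.
Being central in `E`, it is trivial. -/
theorem mem_center_of_apply_eq_smul [FiniteDimensional ℂ H] [Nontrivial A] [Nontrivial B]
    (hE : commutator E ≤ Subgroup.center E) (hρ : IsErrorRepresentation ρ)
    (hf : ∀ a a' b b', inner ℂ (f a b) (f a' b') = inner ℂ a a' * inner ℂ b b')
    (hact : ∀ (l : L) a b, ρ l (f a b) = f (α l a) b) {l : L} {c : ℂ}
    (h : ∀ a, α l a = c • a) : l ∈ Subgroup.center L := by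
  obtain ⟨a, ha⟩ := exists_ne (0 : A)
  obtain ⟨b, hb⟩ := exists_ne (0 : B)
  have hab : f a b ≠ 0 := fun h0 => by
    have := hf a a b b
    rw [h0, inner_zero_left, eq_comm, mul_eq_zero, inner_self_eq_zero, inner_self_eq_zero] at this
    exact this.elim ha hb
  refine Subgroup.mem_center_iff.2 fun l' => Subtype.ext ?_
  refine (commutatorElement_eq_one_iff_mul_comm.1 (eq_one_of_apply_eq hρ
    (commutatorElement_mem_center hE (l : E) l')
    (v := ρ (l' * l : E) (f a b)) (apply_ne_zero _ hab) ?_)).symm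
  rw [← Module.End.mul_apply, ← map_mul]
  have : ⁅(l : E), (l' : E)⁆ * (l' * l) = l * l' := by simp [commutatorElement_def, mul_assoc]
  rw [this, map_mul, map_mul, Module.End.mul_apply, Module.End.mul_apply, hact, hact, hact, hact,
    h, h, map_smul (α l')]

end Detection

end CliffordCode

end

/-! ### Assembly of the theorem. -/

theorem theorem2 {E : Type*} [Group E] [Finite E]
    {H : Type*} [NormedAddCommGroup H] [InnerProductSpace ℂ H] [FiniteDimensional ℂ H]
    (ρ : Representation ℂ E H) (N : Subgroup E) [N.Normal] [Fintype N] (χ : N → ℂ)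
    (hE : commutator E ≤ Subgroup.center E)
    (hC : CliffordCode.IsCliffordData ρ N χ) :
    CliffordCode.inertiaGroup N χ = CliffordCode.centralizerOfCenter N ∧
    ∀ L : Subgroup E,
      (CliffordCode.centralizerOfCenter N : Set E) = (L : Set E) * (N : Set E) →
      ⁅L, N⁆ = ⊥ →
      ∃ D : CliffordCode.OperatorCode (CliffordCode.code ρ N χ),
        D.IsCompatible ρ L N χ ∧
        (Module.finrank ℂ D.A : ℝ) =
          (Nat.card (Subgroup.center E ⊓ N : Subgroup E) : ℝ)
            * Real.sqrt ((Subgroup.center E).index : ℝ)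
            * Real.sqrt ((Subgroup.center N).index : ℝ) / (Nat.card N : ℝ) ∧
        (Module.finrank ℂ D.B : ℝ) = Real.sqrt ((Subgroup.center N).index : ℝ) ∧
        ∀ e : E, D.Detects (ρ e) ↔
          e ∉ (CliffordCode.centralizerOfCenter N : Set E) \
            ((CliffordCode.centerOf L : Set E) * (N : Set E)) := by
  open CliffordCode in
  obtain ⟨hρ, ⟨n, σ, hσ, rfl⟩, hpos⟩ := hC
  obtain ⟨k, β, J, hβ, hχ, hJ⟩ := exists_isometric_model
    (τ := (MonoidHom.comp ρ N.subtype : Representation ℂ N H)) hσ hpos.ne'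
  replace hJ : ∀ n b, J (β n b) = ρ n (J b) := hJ
  rw [← hχ]
  refine ⟨inertiaGroup_eq_centralizerOfCenter hE hρ hJ hβ, fun L hL hLN => ?_⟩
  have := nontrivial_of_isIrreducible hβ
  have hβu : ∀ g x y, inner ℂ (β g x) (β g y) = inner ℂ x y := fun g x y => by
    rw [← J.inner_map_map, hJ, hJ, hρ.unitary, J.inner_map_map]
  obtain ⟨m, u, hu⟩ := exists_multiplicity_space
    (τ := (MonoidHom.comp ρ N.subtype : Representation ℂ N H)) (β := β)
    (fun g x y => hρ.unitary g x y) hβu hβ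
  -- The embedding `J` is itself a nonzero element of the multiplicity space.
  have : Nontrivial (EuclideanSpace ℂ (Fin m)) := by
    let T : β.IntertwiningMap (MonoidHom.comp ρ N.subtype : Representation ℂ N H) :=
      ⟨J.toLinearMap, fun g => LinearMap.ext fun b => hJ g b⟩
    obtain ⟨b, hb⟩ := exists_ne (0 : EuclideanSpace ℂ (Fin k))
    refine ⟨u.symm T, 0, fun h => hb (J.injective ?_)⟩
    have hT : T = 0 := (LinearEquiv.map_eq_zero_iff u.symm).1 h
    rw [map_zero]
    exact congrArg (fun S : β.IntertwiningMap _ => S b) hT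
  let f : EuclideanSpace ℂ (Fin m) →ₗ[ℂ] EuclideanSpace ℂ (Fin k) →ₗ[ℂ] H :=
    Representation.IntertwiningMap.toLinearMapl _ _ ∘ₗ u.toLinearMap
  have hfu : ∀ a b, f a b = u a b := fun a b => rfl
  have hf : ∀ a a' b b', inner ℂ (f a b) (f a' b') = inner ℂ a a' * inner ℂ b b' := hu
  let α : Representation ℂ L (EuclideanSpace ℂ (Fin m)) :=
    conjRepresentation (multiplicityRepresentation ρ β hLN) u.symm
  have hact : ∀ (l : L) (n : N) a b, ρ (l * n : E) (f a b) = f (α l a) (β n b) := by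
    intro l n a b
    rw [hfu, hfu, conjRepresentation_apply, LinearEquiv.apply_symm_apply, LinearEquiv.symm_symm,
      multiplicityRepresentation_apply, (u a).isIntertwining, map_mul]
    rfl
  have hproj : ∀ a b, projector ρ N β.character (f a b) = f a b := fun a b =>
    projector_apply_intertwiningMap hβ (u a) b
  have hα : α.IsIrreducible := isIrreducible_of_code hE hρ hβ hL hf hact hproj
  obtain ⟨F, hF⟩ := exists_tensor_isometry f hf
  have hrange := range_tensor_isometry_eq_code hE hρ hβ hL hf hact hproj hF
  have hmem : ∀ a b, f a b ∈ code ρ N β.character := apply_mem_code hproj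
  have hdimB : (Module.finrank ℂ (EuclideanSpace ℂ (Fin k)) : ℝ) =
      Real.sqrt ((Subgroup.center N).index : ℝ) :=
    finrank_eq_sqrt_index_center hβ fun n hn => restricted_character_eq_zero hE hρ hJ hn
  let iso : EuclideanSpace ℂ (Fin m) ⊗[ℂ] EuclideanSpace ℂ (Fin k) ≃ₗᵢ[ℂ]
      code ρ N β.character :=
    F.equivRange.trans (LinearIsometryEquiv.ofEq _ _ hrange)
  have hiso : ∀ a b, (iso (a ⊗ₜ b) : H) = f a b := hF
  let D : OperatorCode (code ρ N β.character) :=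
    { A := EuclideanSpace ℂ (Fin m), B := EuclideanSpace ℂ (Fin k), iso := iso }
  have hact' : ∀ (l : L) a b, ρ l (f a b) = f (α l a) b := fun l a b => by
    have := hact l 1 a b
    rwa [Subgroup.coe_one, mul_one, map_one, Module.End.one_apply] at this
  refine ⟨D, ⟨α, β, hα, hβ, rfl, fun l n a b => ?_⟩, ?_, hdimB, fun e => ?_⟩
  · exact ((congrArg (ρ (l * n : E)) (hiso a b)).trans (hact l n a b)).trans (hiso _ _).symm
  · change (Module.finrank ℂ (EuclideanSpace ℂ (Fin m)) : ℝ) = _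
    -- `P` is the identity on `A ⊗ B`, which contains the code, so it is idempotent and its trace is
    -- `dim A · dim B`. Comparison with `trace_projector` determines `dim A`.
    have htrace : LinearMap.trace ℂ H (projector ρ N β.character) =
        (Module.finrank ℂ (EuclideanSpace ℂ (Fin m)) : ℂ) *
          Module.finrank ℂ (EuclideanSpace ℂ (Fin k)) := by
      have hidem : LinearMap.IsProj (code ρ N β.character) (projector ρ N β.character) := by
        refine ⟨fun v => ⟨v, rfl⟩, fun w hw => ?_⟩
        have hle : code ρ N β.character ≤
            LinearMap.eqLocus (projector ρ N β.character) LinearMap.id :=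
          (code_le_map₂ hE hρ hβ hL hf hact hproj top_ne_bot fun _ _ _ => Submodule.mem_top).trans
            (Submodule.map₂_le.2 fun a _ b _ => hproj a b)
        exact hle hw
      rw [hidem.trace, ← iso.toLinearEquiv.finrank_eq, Module.finrank_tensorProduct, Nat.cast_mul]
    rw [trace_projector hE hρ hJ] at htrace
    have htrace' : (Module.finrank ℂ (EuclideanSpace ℂ (Fin k)) : ℝ) ^ 2 * Module.finrank ℂ H *
        Nat.card (Subgroup.center E ⊓ N : Subgroup E) / Nat.card N =
        (Module.finrank ℂ (EuclideanSpace ℂ (Fin m)) : ℝ) *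
          Module.finrank ℂ (EuclideanSpace ℂ (Fin k)) := by
      apply Complex.ofReal_injective
      push_cast
      exact htrace
    have hk : (Module.finrank ℂ (EuclideanSpace ℂ (Fin k)) : ℝ) ≠ 0 := by
      exact_mod_cast Module.finrank_pos.ne'
    rw [← hdimB, ← hρ.degree]
    apply mul_right_cancel₀ hk
    rw [← htrace']
    ring
  · have hdet : D.Detects (ρ e) ↔ ∃ M : EuclideanSpace ℂ (Fin k) →ₗ[ℂ] EuclideanSpace ℂ (Fin k),
        ∀ a b, (code ρ N β.character).starProjection (ρ e (f a b)) = f a (M b) := by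
      refine exists_congr fun M => forall₂_congr fun a b => ?_
      change (code ρ N β.character).starProjection (ρ e (iso (a ⊗ₜ b) : H)) =
        (iso (a ⊗ₜ M b) : H) ↔ _
      rw [hiso, hiso]
    rw [hdet, Set.mem_sdiff, not_and_not_right]
    by_cases he : e ∈ centralizerOfCenter N
    · refine ⟨?_, fun h => ?_⟩
      · rintro ⟨M, hM⟩ -
        obtain ⟨l, hl, n, hn, rfl⟩ : e ∈ (L : Set E) * (N : Set E) := hL ▸ he
        obtain ⟨c, hc⟩ := exists_eq_smul_of_tensor_eq hf (S := α ⟨l, hl⟩) (R := β ⟨n, hn⟩) (M := M)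
          (fun b hb => apply_ne_zero _ hb) fun a b => by
            rw [← hM, ← hact ⟨l, hl⟩ ⟨n, hn⟩, Submodule.starProjection_eq_self_iff.2]
            rw [hact ⟨l, hl⟩ ⟨n, hn⟩]
            exact hmem _ _
        exact ⟨l, ⟨⟨l, hl⟩, mem_center_of_apply_eq_smul hE hρ hf hact' hc, rfl⟩, n, hn, rfl⟩
      · obtain ⟨_, ⟨z, hz, rfl⟩, n, hn, rfl⟩ := h he
        obtain ⟨c, hc⟩ := exists_eq_smul_of_mem_center hα hz
        -- The scalar by which `z ∈ Z(L)` acts on the irreducible `A` is moved to the factor `B`.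
        refine ⟨c • β ⟨n, hn⟩, fun a b => ?_⟩
        have : ρ (L.subtype z * n) (f a b) = f a ((c • β ⟨n, hn⟩) b) := by
          rw [Subgroup.subtype_apply, hact z ⟨n, hn⟩, hc, map_smul, LinearMap.smul_apply,
            LinearMap.smul_apply, map_smul]
        rw [this]
        exact Submodule.starProjection_eq_self_iff.2 (hmem _ _)
    -- Outside the inertia group the compression to the code is zero, hence `M = 0`.
    · refine iff_of_true ⟨0, fun a b => ?_⟩ fun h => absurd h he
      rw [LinearMap.zero_apply, map_zero]
      exact (Submodule.starProjection_apply_eq_zero_iff _).2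
        (apply_mem_orthogonal_of_notMem hE hρ hβ he (hmem a b))
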